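/- Let $X$ be a measurable space, $\nu$ a probability measure on $X$ with $L^2(\nu)$ separable, $\Omega=X^{\mathbb Z^d}$ and $\mu=\nu^{\mathbb Z^d}$; $\langle\cdot\rangle$ is the mean and $\langle\cdot,\cdot\rangle$ the inner product of $L^2(\mu)$. Let $\mathcal D\subset L^2(\mu)$ be the space of local functions (those depending on finitely many coordinates), let $s_f$ be the least $n\ge 0$ such that $f\in\mathcal D$ does not depend on $(\eta_x)_{|x|\ge n+1}$, where $|x|=\max_\alpha|x_\alpha|$, and let $(\tau_zf)(\eta)=f((\eta_{x+z})_{x})$. A linear operator $A:\mathcal D\to\mathcal D$ is local if for some $r\ge 0$ one has $s_{Af}\le\max\{s_f,r\}$ for all $f$. Let $(L_{x,y})_{x,y\in\mathbb Z^d}$ be local operators with $L_{x,y}\mathbf 1=0$, $L_{x,x}=0$, $L_{x,y}=\tau_xL_{0,y-x}\tau_{-x}$, $L_{0,z}=0$ for $|z|>R$ (some $R>0$), $L_{0,z}=L_{z,0}$, $\langle L_{0,x}f,g\rangle=\langle f,L_{0,x}g\rangle$ and $\mathcal D_{0,x}(f):=\langle -L_{0,x}f,f\rangle\ge 0$ for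 $f,g\in\mathcal D$. Let $\xi:X\to\mathbb R$ be measurable with $\xi\in L^2(\nu)$ and, with $\xi_x=\xi(\eta_x)$, $L_{x,y}(\xi_x+\xi_y)=0$ and $L_{x,y}\xi_z=0$ for $z\ne x,y$. Put $j_{0,x}=2L_{0,x}\xi_0$ and $j_\alpha=\sum_x x_\alpha j_{0,x}$. Suppose that $L=\sum_{x,y}L_{x,y}$ defines a stationary Markov process $\eta(t)$ with initial law $\mu$: its transition semigroup $e^{tL}$ on $L^2(\mu)$ commutes with the shifts and, for every $f\in\mathcal D$, the series $\sum_{x,y}L_{x,y}f$ converges in $L^2(\mu)$ to the derivative of $e^{tL}f$ at $t=0$. Let $\mathcal H$ be the completion of $\mathcal D$ for the degenerate scalar product $\langle f|g\rangle=\sum_{x}(\langle \tau_xf\,g\rangle-\langle f\rangle\langle g\rangle)$, and suppose that $e^{tL}$ induces a strongly continuous self-adjoint semigroup $T_t$ on $\mathcal H$, i.e. $\langle f|T_tg\rangle=\sum_x(\langle\tau_xf\,e^{tL}g\rangle-\langle f\rangle\langle g\rangle)$ for $f,g\in\mathcal D$, whose generator $\tilde L$ has $\mathcal D$ in its domain.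 With $S(x,t)=\mathbb E[\xi_x(t)\xi_0(0)]-\langle\xi_0\rangle^2$, suppose that $\chi=\sum_xS(x,t)$ converges, is independent of $t$ and is nonzero, and that the limits $$D_{\alpha\beta}=\lim_{t\to\infty}\frac1t\,\frac1{2\chi}\sum_xx_\alpha x_\beta S(x,t)$$ exist (with convergent sums). Put $D^s_{\alpha\beta}=\frac1\chi\sum_xx_\alpha x_\beta\mathcal D_{0,x}(\xi_0)$. Assume the Green–Kubo formula $$D_{\alpha\beta}=\frac1{2\chi}\Big(2\sum_xx_\alpha x_\beta\mathcal D_{0,x}(\xi_0)-\frac12\int_0^\infty\sum_x\langle j_\alpha\,e^{tL}\tau_xj_\beta\rangle\,dt\Big)$$ (with convergent sums and an integrable integrand) and the variational formula $$\sum_{\alpha,\beta}\ell_\alpha\ell_\beta D_{\alpha\beta}=\sum_{\alpha,\beta}\ell_\alpha\ell_\beta D^s_{\alpha\beta}+\frac1\chi\inf_{f\in\mathcal D}\Big\{-2\Big\langle\tfrac12\sum_\alpha\ell_\alpha j_\alpha\Big|f\Big\rangle-\langle f|\tilde Lf\rangle\Big\}\qquad(\ell\in\mathbb R^d).$$ Let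 $\mathfrak G=\{\sum_{\alpha=1}^d(\tau_{e_\alpha}g_\alpha-g_\alpha):g_\alpha\in\mathcal D\}$. Then the gradient condition ($j_\alpha\in\mathfrak G$ for all $\alpha$) holds if and only if $D=D^s$. Moreover, if the interaction is nearest-neighbour ($L_{0,z}=0$ unless $z=\pm e_\alpha$ for some $\alpha$), then $D=D^s$ if and only if $j_{0,e_\alpha}\in\mathfrak G$ for all $\alpha$. -/

import Mathlib

open MeasureTheory ProbabilityTheory Filter Topology
open scoped NNReal ENNReal

noncomputable section

namespace LatticeSystem

/-- The lattice `ℤ^d`. -/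
abbrev Lat (d : ℕ) : Type := Fin d → ℤ

/-- The configuration space `Ω = X^{ℤ^d}`, with the product σ-algebra. -/
abbrev Conf (d : ℕ) (X : Type*) : Type _ := Lat d → X

/-- `|x| = max_α |x_α|`. -/
def supNorm {d : ℕ} (x : Lat d) : ℕ := Finset.univ.sup fun α => (x α).natAbs

/-- The unit vector in direction `α`. -/
def unitVec {d : ℕ} (α : Fin d) : Lat d := Pi.single α 1

section Setting

variable {d : ℕ} {X : Type*} [MeasurableSpace X]

/-- The product measure `μ = ν^{ℤ^d}`. -/
def prodMeasure (d : ℕ) (ν : Measure X) [IsProbabilityMeasure ν] : Measure (Conf d X) :=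
  Measure.infinitePi fun _ : Lat d => ν

instance (ν : Measure X) [IsProbabilityMeasure ν] : IsProbabilityMeasure (prodMeasure d ν) := by
  unfold prodMeasure; infer_instance

/-- The space `L²(μ)`. -/
abbrev L2 (d : ℕ) (ν : Measure X) [IsProbabilityMeasure ν] : Type _ := Lp ℝ 2 (prodMeasure d ν)

/-- The shift of configurations, `(τ_z η)_x = η_{x+z}`, so that `τ_z` maps a function of `η_x`
to the same function of `η_{x+z}`. -/
def shiftConf (z : Lat d) (η : Conf d X) : Conf d X := fun x => η (x + z)

variable (ν : Measure X) [IsProbabilityMeasure ν]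

theorem measurePreserving_shiftConf (z : Lat d) :
    MeasurePreserving (shiftConf (X := X) z) (prodMeasure d ν) (prodMeasure d ν) := by
  have h := Measure.infinitePi_map_piCongrLeft (X := fun _ : Lat d => X) (fun _ => ν)
    (Equiv.subRight z)
  refine ⟨measurable_pi_lambda _ fun x => measurable_pi_apply _, ?_⟩
  have e : (shiftConf (X := X) z) =
      MeasurableEquiv.piCongrLeft (fun _ : Lat d => X) (Equiv.subRight z) := by
    funext η x
    have := MeasurableEquiv.piCongrLeft_apply_apply (β := fun _ : Lat d => X)
      (Equiv.subRight z) η (x + z)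
    simpa [shiftConf] using this.symm
  rw [e]
  exact h

/-- The shift `τ_z` on `L²(μ)`. -/
def shiftL2 (z : Lat d) : L2 d ν →ₗᵢ[ℝ] L2 d ν :=
  Lp.compMeasurePreservingₗᵢ ℝ (shiftConf z) (measurePreserving_shiftConf ν z)

variable {ν}

/-- The element `f` of `L²(μ)` depends only on the coordinates in `A`
(up to a `μ`-null set). -/
def DependsOnly (A : Set (Lat d)) (f : L2 d ν) : Prop :=
  ∃ g : Conf d X → ℝ, Measurable g ∧ DependsOn g A ∧ f =ᵐ[prodMeasure d ν] g

theorem DependsOnly.mono {A B : Set (Lat d)} (h : A ⊆ B) {f : L2 d ν} (hf : DependsOnly A f) :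
    DependsOnly B f := by
  obtain ⟨g, hg, hd, he⟩ := hf
  exact ⟨g, hg, hd.mono h, he⟩

theorem DependsOnly.add {A : Set (Lat d)} {f g : L2 d ν} (hf : DependsOnly A f)
    (hg : DependsOnly A g) : DependsOnly A (f + g) := by
  obtain ⟨f', hf', df, ef⟩ := hf
  obtain ⟨g', hg', dg, eg⟩ := hg
  refine ⟨f' + g', hf'.add hg', fun x y h => by simp [df h, dg h], ?_⟩
  exact (Lp.coeFn_add f g).trans (ef.add eg)

theorem DependsOnly.smul {A : Set (Lat d)} {f : L2 d ν} (c : ℝ) (hf : DependsOnly A f) :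
    DependsOnly A (c • f) := by
  obtain ⟨f', hf', df, ef⟩ := hf
  refine ⟨c • f', hf'.const_smul c, fun x y h => by simp [df h], ?_⟩
  exact (Lp.coeFn_smul c f).trans (ef.const_smul c)

theorem DependsOnly.shift {A : Set (Lat d)} {f : L2 d ν} (z : Lat d) (hf : DependsOnly A f) :
    DependsOnly ((fun x => x + z) '' A) (shiftL2 ν z f) := by
  obtain ⟨f', hf', df, ef⟩ := hf
  have hm := measurePreserving_shiftConf ν z
  refine ⟨f' ∘ shiftConf z, hf'.comp hm.measurable, fun x y h => ?_, ?_⟩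
  · exact df fun a ha => h _ ⟨a, ha, rfl⟩
  · exact (Lp.coeFn_compMeasurePreserving f hm).trans (hm.quasiMeasurePreserving.ae_eq_comp ef)

variable (d ν)

/-- The space `𝒟` of local functions in `L²(μ)`. -/
def LocalL2 : Submodule ℝ (L2 d ν) where
  carrier := {f | ∃ A : Finset (Lat d), DependsOnly (A : Set (Lat d)) f}
  zero_mem' := ⟨∅, 0, measurable_zero, fun _ _ _ => rfl, Lp.coeFn_zero _ _ _⟩
  add_mem' := by
    classical
    rintro f g ⟨A, hA⟩ ⟨B, hB⟩
    refine ⟨A ∪ B, (hA.mono ?_).add (hB.mono ?_)⟩ <;> simp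
  smul_mem' := fun c f ⟨A, hA⟩ => ⟨A, hA.smul c⟩

variable {d ν}

/-- `s_f`, the least `n ≥ 0` such that `f` does not depend on `(η_x)_{|x| ≥ n+1}`. -/
def locRadius (f : LocalL2 d ν) : ℕ := sInf {n : ℕ | DependsOnly {x | supNorm x ≤ n} (f : L2 d ν)}

/-- A local operator on `𝒟`. -/
def IsLocalOperator (T : LocalL2 d ν →ₗ[ℝ] LocalL2 d ν) : Prop :=
  ∃ r : ℕ, ∀ f, locRadius (T f) ≤ max (locRadius f) r

/-- The shift `τ_z` on `𝒟`. -/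
def shift (z : Lat d) : LocalL2 d ν →ₗ[ℝ] LocalL2 d ν :=
  (shiftL2 ν z).toLinearMap.restrict fun f ⟨A, hA⟩ => by
    classical
    exact ⟨A.image fun x => x + z, by simpa using hA.shift z⟩

/-- The mean `⟨f⟩`. -/
def mean (f : LocalL2 d ν) : ℝ := ∫ η, (f : L2 d ν) η ∂prodMeasure d ν

/-- An observable of a single site, `η ↦ φ(η_x)`, as an element of `𝒟`. -/
def siteObs {φ : X → ℝ} (hφ : Measurable φ) (h2 : MemLp φ 2 ν) (x : Lat d) : LocalL2 d ν :=
  ⟨(h2.comp_measurePreserving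
      (measurePreserving_eval_infinitePi (fun _ : Lat d => ν) x)).toLp (μ := prodMeasure d ν)
        (fun η : Conf d X => φ (η x)),
    {x}, fun η => φ (η x), hφ.comp (measurable_pi_apply x),
    fun η ζ h => congrArg φ (h x (by simp)), MemLp.coeFn_toLp _⟩

variable (d ν) in
/-- The constant function `1`. -/
def oneFun : LocalL2 d ν :=
  ⟨(memLp_const (1 : ℝ)).toLp (fun _ => (1 : ℝ)), ∅, fun _ => 1, measurable_const,
    fun _ _ _ => rfl, MemLp.coeFn_toLp _⟩

/-- The gradient space `𝔊 = {∑_α (τ^α g_α - g_α) : g_α ∈ 𝒟}`. -/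
def gradSpace (d : ℕ) (ν : Measure X) [IsProbabilityMeasure ν] : Set (LocalL2 d ν) :=
  {f | ∃ g : Fin d → LocalL2 d ν, f = ∑ α, (shift (unitVec α) (g α) - g α)}

/-- The summand `⟨τ_x f g⟩ - ⟨f⟩⟨g⟩`. -/
def shiftCov (f g : LocalL2 d ν) (x : Lat d) : ℝ :=
  inner ℝ (shift x f : L2 d ν) (g : L2 d ν) - mean f * mean g

/-- The degenerate scalar product `⟨f | g⟩ = ∑_x (⟨τ_x f g⟩ - ⟨f⟩⟨g⟩)` on `𝒟`. -/
def scalar (f g : LocalL2 d ν) : ℝ := ∑' x : Lat d, shiftCov f g x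

theorem mean_eq_inner (f : LocalL2 d ν) :
    mean f = inner ℝ (oneFun d ν : L2 d ν) (f : L2 d ν) := by
  rw [L2.inner_def, mean]
  refine integral_congr_ae ?_
  filter_upwards [MemLp.coeFn_toLp (memLp_const (μ := prodMeasure d ν) (p := 2) (1 : ℝ))] with η h
  have h' : (oneFun d ν : L2 d ν) η = 1 := h
  simp [h']

theorem mean_add (f g : LocalL2 d ν) : mean (f + g) = mean f + mean g := by
  simp [mean_eq_inner, inner_add_right]

theorem mean_smul (c : ℝ) (f : LocalL2 d ν) : mean (c • f) = c * mean f := by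
  simp [mean_eq_inner, inner_smul_right]

theorem mean_shift (z : Lat d) (f : LocalL2 d ν) : mean (shift z f) = mean f := by
  have hm := measurePreserving_shiftConf (X := X) (d := d) ν z
  unfold mean
  have h : ((shift z f : LocalL2 d ν) : L2 d ν) =ᵐ[prodMeasure d ν]
      ((f : L2 d ν) : Conf d X → ℝ) ∘ shiftConf z :=
    Lp.coeFn_compMeasurePreserving (f : L2 d ν) hm
  rw [integral_congr_ae h]
  have := integral_map (μ := prodMeasure d ν) hm.measurable.aemeasurable
    (f := ((f : L2 d ν) : Conf d X → ℝ))
    (by rw [hm.map_eq]; exact (Lp.aestronglyMeasurable _))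
  rw [hm.map_eq] at this
  simpa using this.symm

theorem shift_shift (z w : Lat d) (f : LocalL2 d ν) : shift z (shift w f) = shift (w + z) f := by
  have hz := measurePreserving_shiftConf (X := X) (d := d) ν z
  have hw := measurePreserving_shiftConf (X := X) (d := d) ν w
  have hwz := measurePreserving_shiftConf (X := X) (d := d) ν (w + z)
  apply Subtype.ext
  apply Lp.ext
  have h1 : ((shift z (shift w f) : LocalL2 d ν) : L2 d ν) =ᵐ[prodMeasure d ν]
      ((shift w f : L2 d ν) : Conf d X → ℝ) ∘ shiftConf z :=
    Lp.coeFn_compMeasurePreserving (shift w f : L2 d ν) hz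
  have h2 : ((shift w f : LocalL2 d ν) : L2 d ν) =ᵐ[prodMeasure d ν]
      ((f : L2 d ν) : Conf d X → ℝ) ∘ shiftConf w :=
    Lp.coeFn_compMeasurePreserving (f : L2 d ν) hw
  have h3 : ((shift (w + z) f : LocalL2 d ν) : L2 d ν) =ᵐ[prodMeasure d ν]
      ((f : L2 d ν) : Conf d X → ℝ) ∘ shiftConf (w + z) :=
    Lp.coeFn_compMeasurePreserving (f : L2 d ν) hwz
  refine h1.trans ((hz.quasiMeasurePreserving.ae_eq_comp h2).trans ?_)
  refine EventuallyEq.trans (.of_eq ?_) h3.symm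
  funext η
  refine congrArg ((f : L2 d ν) : Conf d X → ℝ) (funext fun x => ?_)
  simp only [shiftConf, add_assoc]

theorem shift_zero (f : LocalL2 d ν) : shift 0 f = f := by
  apply Subtype.ext
  apply Lp.ext
  have h : ((shift 0 f : LocalL2 d ν) : L2 d ν) =ᵐ[prodMeasure d ν]
      ((f : L2 d ν) : Conf d X → ℝ) ∘ shiftConf 0 :=
    Lp.coeFn_compMeasurePreserving (f : L2 d ν) (measurePreserving_shiftConf ν 0)
  refine h.trans (.of_eq ?_)
  funext η
  exact congrArg ((f : L2 d ν) : Conf d X → ℝ) (funext fun x => by simp [shiftConf])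

theorem inner_shift_shift (z : Lat d) (f g : LocalL2 d ν) :
    inner ℝ (shift z f : L2 d ν) (shift z g : L2 d ν) = inner ℝ (f : L2 d ν) (g : L2 d ν) :=
  (shiftL2 ν z).inner_map_map _ _

theorem shiftCov_symm (f g : LocalL2 d ν) (x : Lat d) : shiftCov f g x = shiftCov g f (-x) := by
  unfold shiftCov
  rw [← inner_shift_shift x (shift (-x) g) f, shift_shift, neg_add_cancel, shift_zero,
    real_inner_comm, mul_comm]

/-- Functions that depend on disjoint sets of coordinates are uncorrelated. -/
theorem inner_eq_of_disjoint {A B : Finset (Lat d)} (hAB : Disjoint A B) {f g : LocalL2 d ν}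
    (hf : DependsOnly (A : Set (Lat d)) (f : L2 d ν))
    (hg : DependsOnly (B : Set (Lat d)) (g : L2 d ν)) :
    inner ℝ (f : L2 d ν) (g : L2 d ν) = mean f * mean g := by
  classical
  obtain ⟨f', hf', df, ef⟩ := hf
  obtain ⟨g', hg', dg, eg⟩ := hg
  obtain ⟨x₀⟩ : Nonempty X := ν.nonempty_of_neZero
  have key : ∀ (C : Finset (Lat d)) (h : Conf d X → ℝ), Measurable h →
      DependsOn h (C : Set (Lat d)) →
      ∃ H : (C → X) → ℝ, Measurable H ∧ h = fun η => H fun i : C => η i := by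
    intro C h hh hd
    refine ⟨fun y => h fun i => if hi : i ∈ C then y ⟨i, hi⟩ else x₀, hh.comp ?_, ?_⟩
    · refine measurable_pi_lambda _ fun i => ?_
      by_cases hi : i ∈ C
      · simpa [hi] using measurable_pi_apply _
      · simp [hi]
    · funext η
      refine hd fun i hi => ?_
      have hi' : i ∈ C := hi
      simp [hi']
  obtain ⟨F, hF, eF⟩ := key A f' hf' df
  obtain ⟨G, hG, eG⟩ := key B g' hg' dg
  have hind : iIndepFun (fun (i : Lat d) (η : Conf d X) => η i) (prodMeasure d ν) :=
    iIndepFun_infinitePi (P := fun _ : Lat d => ν) (X := fun _ x => x) (fun _ => measurable_id)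
  have h2 := (hind.indepFun_finset A B hAB fun i => measurable_pi_apply i).comp hF hG
  have h3 : IndepFun f' g' (prodMeasure d ν) := by rw [eF, eG]; exact h2
  rw [L2.inner_def, mean, mean, integral_congr_ae ef, integral_congr_ae eg,
    ← h3.integral_fun_mul_eq_mul_integral hf'.aestronglyMeasurable hg'.aestronglyMeasurable]
  refine integral_congr_ae ?_
  filter_upwards [ef, eg] with η h1 h2
  simp [h1, h2, mul_comm]

theorem finite_support_shiftCov (f g : LocalL2 d ν) : (Function.support (shiftCov f g)).Finite := by
  classical
  obtain ⟨f, A, hA⟩ := f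
  obtain ⟨g, B, hB⟩ := g
  refine ((A ×ˢ B).image fun p => p.2 - p.1).finite_toSet.subset fun x hx => ?_
  by_contra hn
  apply hx
  have hdis : Disjoint (A.image fun a => a + x) B := by
    rw [Finset.disjoint_left]
    rintro b hb hb'
    obtain ⟨a, ha, rfl⟩ := Finset.mem_image.1 hb
    exact hn (Finset.mem_coe.2 (Finset.mem_image.2 ⟨(a, a + x), by simp [ha, hb'], by simp⟩))
  have hs : DependsOnly ((A.image fun a => a + x : Finset (Lat d)) : Set (Lat d))
      ((shift x ⟨f, A, hA⟩ : LocalL2 d ν) : L2 d ν) := by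
    rw [Finset.coe_image]; exact hA.shift x
  rw [shiftCov, inner_eq_of_disjoint hdis hs (g := ⟨g, B, hB⟩) hB, mean_shift, sub_self]

theorem summable_shiftCov (f g : LocalL2 d ν) : Summable (shiftCov f g) :=
  summable_of_hasFiniteSupport (finite_support_shiftCov f g)

theorem scalar_symm (f g : LocalL2 d ν) : scalar f g = scalar g f := by
  unfold scalar
  rw [← (Equiv.neg (Lat d)).tsum_eq (shiftCov g f)]
  exact tsum_congr fun x => shiftCov_symm f g x

theorem scalar_add_left (f g h : LocalL2 d ν) : scalar (f + g) h = scalar f h + scalar g h := by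
  unfold scalar
  rw [← (summable_shiftCov f h).tsum_add (summable_shiftCov g h)]
  refine tsum_congr fun x => ?_
  simp only [shiftCov, map_add, mean_add, Submodule.coe_add, inner_add_left]
  ring

theorem scalar_smul_left (c : ℝ) (f h : LocalL2 d ν) : scalar (c • f) h = c * scalar f h := by
  unfold scalar
  rw [← tsum_mul_left]
  refine tsum_congr fun x => ?_
  simp only [shiftCov, map_smul, mean_smul, Submodule.coe_smul, real_inner_smul_left]
  ring

theorem sum_shiftCov_nonneg (f : LocalL2 d ν) (s : Finset (Lat d)) :
    0 ≤ ∑ y ∈ s, ∑ x ∈ s, shiftCov f f (x - y) := by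
  have hone : ∀ z : Lat d, mean (shift z f) = mean f := fun z => mean_shift z f
  set F : LocalL2 d ν := ∑ x ∈ s, shift x f with hF
  have h1 : ∑ y ∈ s, ∑ x ∈ s, shiftCov f f (x - y) =
      inner ℝ (F : L2 d ν) (F : L2 d ν) - mean F * mean F := by
    have hm : mean F = ∑ x ∈ s, mean f := by
      rw [mean_eq_inner, hF]
      simp only [AddSubmonoidClass.coe_finsetSum, inner_sum]
      exact Finset.sum_congr rfl fun x _ => by rw [← mean_eq_inner, hone]
    rw [hm, hF]
    simp only [AddSubmonoidClass.coe_finsetSum, inner_sum, sum_inner]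
    rw [Finset.sum_mul_sum, ← Finset.sum_sub_distrib]
    refine Finset.sum_congr rfl fun y _ => ?_
    rw [← Finset.sum_sub_distrib]
    refine Finset.sum_congr rfl fun x _ => ?_
    rw [shiftCov, ← inner_shift_shift y, shift_shift, sub_add_cancel]
  have h2 : inner ℝ (oneFun d ν : L2 d ν) (oneFun d ν : L2 d ν) = 1 := by
    have h : (oneFun d ν : L2 d ν) =ᵐ[prodMeasure d ν] fun _ => (1 : ℝ) :=
      MemLp.coeFn_toLp (memLp_const (1 : ℝ))
    rw [← mean_eq_inner, mean, integral_congr_ae h]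
    simp
  rw [h1, mean_eq_inner]
  have h3 := real_inner_mul_inner_self_le (oneFun d ν : L2 d ν) (F : L2 d ν)
  rw [h2] at h3
  linarith

theorem scalar_self_nonneg (f : LocalL2 d ν) : 0 ≤ scalar f f := by
  classical
  set c := shiftCov f f with hc
  set S := (finite_support_shiftCov f f).toFinset with hS
  have hcS : ∀ x, x ∉ S → c x = 0 := fun x hx => by simpa [hS] using hx
  have hB : scalar f f = ∑ x ∈ S, c x := tsum_eq_sum hcS
  obtain ⟨M, hM⟩ : ∃ M : ℕ, ∀ x ∈ S, ∀ α, (x α).natAbs ≤ M := by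
    refine ⟨S.sup supNorm, fun x hx α => le_trans ?_ (Finset.le_sup hx)⟩
    exact Finset.le_sup (f := fun α => (x α).natAbs) (Finset.mem_univ α)
  set C := ∑ x ∈ S, |c x| with hC
  -- boxes and inner boxes
  let box : ℕ → Finset (Lat d) := fun n => Fintype.piFinset fun _ => Finset.Ico (-(M : ℤ)) (n + M)
  let inn : ℕ → Finset (Lat d) := fun n => Fintype.piFinset fun _ => Finset.Ico (0 : ℤ) n
  have hsub : ∀ n, inn n ⊆ box n := fun n =>
    Fintype.piFinset_subset _ _ fun _ => Finset.Ico_subset_Ico (by simp) (by simp)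
  have card_box : ∀ n, ((box n).card : ℝ) = ((n : ℝ) + 2 * M) ^ d := fun n => by
    have : ((n : ℤ) + M + M).toNat = n + 2 * M := by omega
    simp [box, this]
  have card_inn : ∀ n, ((inn n).card : ℝ) = (n : ℝ) ^ d := fun n => by simp [inn]
  have bound : ∀ n : ℕ, 0 ≤ (n : ℝ) ^ d * scalar f f + (((n : ℝ) + 2 * M) ^ d - (n : ℝ) ^ d) * C := by
    intro n
    have row : ∀ y, ∑ x ∈ box n, c (x - y) = ∑ x ∈ S.filter (fun z => z + y ∈ box n), c x := by
      intro y
      rw [← Finset.sum_image (s := box n) (g := fun x => x - y) (f := c)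
        (fun a _ b _ h => by simpa using h)]
      symm
      refine Finset.sum_subset_zero_on_sdiff (fun z hz => ?_) (fun z hz => ?_) fun _ _ => rfl
      · simp only [Finset.mem_filter] at hz
        exact Finset.mem_image.2 ⟨z + y, hz.2, by simp⟩
      · simp only [Finset.mem_sdiff, Finset.mem_image, Finset.mem_filter] at hz
        obtain ⟨⟨x, hx, rfl⟩, h2⟩ := hz
        apply hcS
        intro h
        exact h2 ⟨h, by simpa using hx⟩
    have h0 := sum_shiftCov_nonneg f (box n)
    rw [← Finset.sum_sdiff (hsub n)] at h0
    have hin : ∑ y ∈ inn n, ∑ x ∈ box n, c (x - y) = (n : ℝ) ^ d * scalar f f := by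
      rw [← card_inn n, ← nsmul_eq_mul, ← Finset.sum_const]
      refine Finset.sum_congr rfl fun y hy => ?_
      rw [row, hB, Finset.filter_true_of_mem]
      intro z hz
      simp only [box, inn, Fintype.mem_piFinset, Finset.mem_Ico, Pi.add_apply] at hy ⊢
      intro α
      have := hM z hz α
      have := hy α
      omega
    have hout : ∑ y ∈ box n \ inn n, ∑ x ∈ box n, c (x - y) ≤
        (((n : ℝ) + 2 * M) ^ d - (n : ℝ) ^ d) * C := by
      have hcard : (((box n \ inn n).card : ℕ) : ℝ) = ((n : ℝ) + 2 * M) ^ d - (n : ℝ) ^ d := by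
        rw [Finset.cast_card_sdiff (hsub n), card_box, card_inn]
      rw [← hcard, ← nsmul_eq_mul]
      refine Finset.sum_le_card_nsmul _ _ _ fun y _ => ?_
      rw [row]
      refine (Finset.sum_le_sum fun x _ => le_abs_self (c x)).trans ?_
      exact Finset.sum_le_sum_of_subset_of_nonneg (Finset.filter_subset _ _)
        fun _ _ _ => abs_nonneg _
    linarith
  have hr : Tendsto (fun n : ℕ => ((n : ℝ) / ((n : ℝ) + 2 * M)) ^ d) atTop (𝓝 1) := by
    have := (tendsto_natCast_div_add_atTop (2 * (M : ℝ))).pow d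
    simpa using this
  have hlim : Tendsto (fun n : ℕ => ((n : ℝ) / ((n : ℝ) + 2 * M)) ^ d * scalar f f +
      (1 - ((n : ℝ) / ((n : ℝ) + 2 * M)) ^ d) * C) atTop (𝓝 (1 * scalar f f + (1 - 1) * C)) :=
    (hr.mul_const _).add ((hr.const_sub 1).mul_const _)
  have := ge_of_tendsto hlim (b := 0) <| by
    filter_upwards [eventually_gt_atTop 0] with n hn
    have hn' : (0 : ℝ) < n := by exact_mod_cast hn
    have hp : (0 : ℝ) < ((n : ℝ) + 2 * M) ^ d := by positivity
    have h := div_nonneg (bound n) hp.le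
    rw [div_pow]
    refine h.trans_eq ?_
    field_simp
  simpa using this

/-- The space `𝒟` with the scalar product `⟨· | ·⟩` instead of that of `L²(μ)`. -/
def PreHilb (d : ℕ) (ν : Measure X) [IsProbabilityMeasure ν] : Type _ := LocalL2 d ν

instance : AddCommGroup (PreHilb d ν) := inferInstanceAs (AddCommGroup (LocalL2 d ν))

instance : Module ℝ (PreHilb d ν) := inferInstanceAs (Module ℝ (LocalL2 d ν))

instance preHilbCore : PreInnerProductSpace.Core ℝ (PreHilb d ν) where
  inner f g := scalar (d := d) (ν := ν) f g
  conj_inner_symm f g := scalar_symm (d := d) (ν := ν) g f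
  re_inner_nonneg f := scalar_self_nonneg (d := d) (ν := ν) f
  add_left f g h := scalar_add_left (d := d) (ν := ν) f g h
  smul_left f g r := scalar_smul_left (d := d) (ν := ν) r f g

instance : SeminormedAddCommGroup (PreHilb d ν) :=
  InnerProductSpace.Core.toSeminormedAddCommGroup (𝕜 := ℝ)

instance : InnerProductSpace ℝ (PreHilb d ν) := .ofCore _

variable (d ν) in
/-- The Hilbert space `ℋ`, the completion of `𝒟` with respect to `⟨· | ·⟩`. -/
abbrev Hilb : Type _ := UniformSpace.Completion (PreHilb d ν)

/-- The canonical map `𝒟 → ℋ`. -/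
def toHilb (f : LocalL2 d ν) : Hilb d ν := ((show PreHilb d ν from f : PreHilb d ν) : Hilb d ν)

theorem inner_toHilb (f g : LocalL2 d ν) : inner ℝ (toHilb f) (toHilb g) = scalar f g :=
  UniformSpace.Completion.inner_coe (𝕜 := ℝ) (E := PreHilb d ν) f g

/-- `g` is the value at `f` of the generator of the family of operators `U`: the derivative of
`t ↦ U_t f` at `t = 0`. -/
def IsGeneratorAt {E : Type*} [NormedAddCommGroup E] [NormedSpace ℝ E]
    (U : ℝ≥0 → E →L[ℝ] E) (f g : E) : Prop :=
  Tendsto (fun t : ℝ≥0 => (t : ℝ)⁻¹ • (U t f - f)) (𝓝[>] 0) (𝓝 g)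

/-- The generator of `U`, used only at points of its domain. -/
def generator {E : Type*} [NormedAddCommGroup E] [NormedSpace ℝ E]
    (U : ℝ≥0 → E →L[ℝ] E) (f : E) : E :=
  limUnder (𝓝[>] (0 : ℝ≥0)) fun t : ℝ≥0 => (t : ℝ)⁻¹ • (U t f - f)

variable (d ν) in
/-- A family of local operators `(L_{x,y})` on `𝒟` together with a conserved quantity `ξ`. -/
structure ParticleSystem where
  L : Lat d → Lat d → LocalL2 d ν →ₗ[ℝ] LocalL2 d ν
  isLocal : ∀ x y, IsLocalOperator (L x y)
  map_one : ∀ x y, L x y (oneFun d ν) = 0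
  diag : ∀ x, L x x = 0
  translation : ∀ x y f, L x y f = shift x (L 0 (y - x) (shift (-x) f))
  finiteRange : ∃ R : ℕ, 0 < R ∧ ∀ z, R < supNorm z → L 0 z = 0
  symmetric : ∀ z, L 0 z = L z 0
  reversible : ∀ x (f g : LocalL2 d ν),
    inner ℝ (L 0 x f : L2 d ν) (g : L2 d ν) = inner ℝ (f : L2 d ν) (L 0 x g : L2 d ν)
  nonpositive : ∀ x (f : LocalL2 d ν), 0 ≤ inner ℝ (-(L 0 x f : L2 d ν)) (f : L2 d ν)
  ξ : X → ℝ
  measurable_ξ : Measurable ξ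
  memLp_ξ : MemLp ξ 2 ν
  conserved : ∀ x y, L x y (siteObs measurable_ξ memLp_ξ x + siteObs measurable_ξ memLp_ξ y) = 0
  unaffected : ∀ x y z, z ≠ x → z ≠ y → L x y (siteObs measurable_ξ memLp_ξ z) = 0

namespace ParticleSystem

variable (𝓢 : ParticleSystem d ν)

/-- `ξ_x = ξ(η_x)`. -/
def ξAt (x : Lat d) : LocalL2 d ν := siteObs 𝓢.measurable_ξ 𝓢.memLp_ξ x

/-- The Dirichlet form `𝒟_{0,x}(f) = ⟨-L_{0,x} f, f⟩`. -/
def dirichlet (x : Lat d) (f : LocalL2 d ν) : ℝ :=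
  inner ℝ (-(𝓢.L 0 x f : L2 d ν)) (f : L2 d ν)

/-- The current `j_{0,x} = 2 L_{0,x} ξ_0`. -/
def bondCurrent (x : Lat d) : LocalL2 d ν := (2 : ℝ) • 𝓢.L 0 x (𝓢.ξAt 0)

/-- The current `j_α = ∑_x x_α j_{0,x}`, a finite sum because of the finite range. -/
def current (α : Fin d) : LocalL2 d ν := ∑ᶠ x : Lat d, ((x α : ℤ) : ℝ) • 𝓢.bondCurrent x

/-- The gradient condition: `j_α ∈ 𝔊` for all `α`. -/
def GradientCondition : Prop := ∀ α, 𝓢.current α ∈ gradSpace d ν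

/-- The interaction is nearest-neighbour: `L_{0,z} = 0` unless `z = ± e_α` for some `α`. -/
def NearestNeighbour : Prop :=
  ∀ z : Lat d, (∀ α, z ≠ unitVec α ∧ z ≠ -unitVec α) → 𝓢.L 0 z = 0

/-- `D^s_{αβ} = χ⁻¹ ∑_x x_α x_β 𝒟_{0,x}(ξ_0)`, a finite sum because of the finite range. -/
def staticMatrix (χ : ℝ) : Matrix (Fin d) (Fin d) ℝ := Matrix.of fun α β =>
  χ⁻¹ * ∑ᶠ x : Lat d, ((x α : ℤ) : ℝ) * ((x β : ℤ) : ℝ) * 𝓢.dirichlet x (𝓢.ξAt 0)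

variable {S : Type*} [MeasurableSpace S]

/-- `η` is, under the probability measure `Q`, a stationary Markov process with initial
distribution `μ` and transition semigroup `P_t = e^{tL}` on `L²(μ)`, where `L = ∑_{x,y} L_{x,y}`
on `𝒟`, and this dynamics is translation invariant, like `L`. -/
structure IsMarkovDynamics (Q : Measure S) (η : ℝ≥0 → S → Conf d X)
    (P : ℝ≥0 → L2 d ν →L[ℝ] L2 d ν) : Prop where
  measurable : ∀ t, Measurable (η t)
  law : ∀ t, Q.map (η t) = prodMeasure d ν
  markov : ∀ (s t : ℝ≥0) (f : L2 d ν),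
    Q[fun ω => f (η (s + t) ω) | ⨆ u ≤ s, MeasurableSpace.comap (η u) inferInstance]
      =ᵐ[Q] fun ω => P t f (η s ω)
  generator : ∀ f : LocalL2 d ν, ∃ g : L2 d ν,
    HasSum (fun p : Lat d × Lat d => (𝓢.L p.1 p.2 f : L2 d ν)) g ∧ IsGeneratorAt P (f : L2 d ν) g
  translation : ∀ t z f, P t (shiftL2 ν z f) = shiftL2 ν z (P t f)

/-- `S(x,t) = 𝔼[ξ_x(t) ξ_0(0)] - ρ²` with `ρ = ⟨ξ_0⟩`. -/
def corr (Q : Measure S) (η : ℝ≥0 → S → Conf d X) (x : Lat d) (t : ℝ≥0) : ℝ :=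
  ∫ ω, 𝓢.ξ (η t ω x) * 𝓢.ξ (η 0 ω 0) ∂Q - mean (𝓢.ξAt 0) ^ 2

/-- `χ = ∑_x S(x,t)`, for every `t`. -/
def IsCompressibility (Q : Measure S) (η : ℝ≥0 → S → Conf d X) (χ : ℝ) : Prop :=
  ∀ t, HasSum (fun x => 𝓢.corr Q η x t) χ

/-- `D_{αβ} = lim_{t → ∞} (1/t) (1/2χ) ∑_x x_α x_β S(x,t)`. -/
def IsDiffusionMatrix (Q : Measure S) (η : ℝ≥0 → S → Conf d X) (χ : ℝ)
    (D : Matrix (Fin d) (Fin d) ℝ) : Prop :=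
  ∀ α β,
    (∀ t, Summable fun x : Lat d => ((x α : ℤ) : ℝ) * ((x β : ℤ) : ℝ) * 𝓢.corr Q η x t) ∧
    Tendsto (fun t : ℝ≥0 => 1 / (t : ℝ) * (1 / (2 * χ)) *
      ∑' x : Lat d, ((x α : ℤ) : ℝ) * ((x β : ℤ) : ℝ) * 𝓢.corr Q η x t) atTop (𝓝 (D α β))

/-- The Green–Kubo formula. The factor `1/2` of the time integral is the one that goes with
`j_α = ∑_x x_α j_{0,x}`, in which every bond is counted from both of its end points. -/
def GreenKubo (P : ℝ≥0 → L2 d ν →L[ℝ] L2 d ν) (χ : ℝ) (D : Matrix (Fin d) (Fin d) ℝ) : Prop :=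
  ∀ α β,
    (∀ t, Summable fun x : Lat d =>
      inner ℝ (𝓢.current α : L2 d ν) (P t (shift x (𝓢.current β) : L2 d ν))) ∧
    IntegrableOn (fun t : ℝ => ∑' x : Lat d,
      inner ℝ (𝓢.current α : L2 d ν) (P t.toNNReal (shift x (𝓢.current β) : L2 d ν)))
      (Set.Ioi 0) ∧
    D α β = 1 / (2 * χ) *
      (2 * ∑ᶠ x : Lat d, ((x α : ℤ) : ℝ) * ((x β : ℤ) : ℝ) * 𝓢.dirichlet x (𝓢.ξAt 0) -
        1 / 2 * ∫ t in Set.Ioi (0 : ℝ), ∑' x : Lat d,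
          inner ℝ (𝓢.current α : L2 d ν) (P t.toNNReal (shift x (𝓢.current β) : L2 d ν)))

/-- The variational formula
`ℓ·Dℓ = ℓ·D^s ℓ + χ⁻¹ inf_{f ∈ 𝒟} {-2⟨½ ∑_α ℓ_α j_α | f⟩ - ⟨f | L̃ f⟩}` for all `ℓ ∈ ℝ^d`,
where `L̃` is the generator of `T`. -/
def VariationalFormula (T : ℝ≥0 → Hilb d ν →L[ℝ] Hilb d ν) (χ : ℝ)
    (D : Matrix (Fin d) (Fin d) ℝ) : Prop :=
  ∀ ℓ : Fin d → ℝ, ∃ I : ℝ,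
    IsGLB (Set.range fun f : LocalL2 d ν =>
      -2 * scalar ((1 / 2 : ℝ) • ∑ α, ℓ α • 𝓢.current α) f -
        inner ℝ (toHilb f) (LatticeSystem.generator T (toHilb f))) I ∧
    ∑ α, ∑ β, ℓ α * ℓ β * D α β = ∑ α, ∑ β, ℓ α * ℓ β * 𝓢.staticMatrix χ α β + χ⁻¹ * I

end ParticleSystem

/-- `T` is the self-adjoint, strongly continuous semigroup on `ℋ` induced by the semigroup `P`
on `L²(μ)`, that is, `⟨f | T_t g⟩ = ∑_x (⟨τ_x f P_t g⟩ - ⟨f⟩⟨g⟩)` for `f, g ∈ 𝒟`, and the domain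
of its generator contains `𝒟`. -/
structure IsInducedSemigroup (P : ℝ≥0 → L2 d ν →L[ℝ] L2 d ν)
    (T : ℝ≥0 → Hilb d ν →L[ℝ] Hilb d ν) : Prop where
  zero : T 0 = 1
  add : ∀ s t, T (s + t) = T s * T t
  continuous : ∀ h, Continuous fun t => T t h
  selfAdjoint : ∀ t, IsSelfAdjoint (T t)
  induced : ∀ t (f g : LocalL2 d ν),
    HasSum (fun x : Lat d =>
      inner ℝ (shift x f : L2 d ν) (P t (g : L2 d ν)) - mean f * mean g)
      (inner ℝ (toHilb f) (T t (toHilb g)))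
  domain : ∀ f : LocalL2 d ν, ∃ h, IsGeneratorAt T (toHilb f) h

end Setting

end LatticeSystem

end

open LatticeSystem

noncomputable section

namespace LatticeSystem

variable {d : ℕ} {X : Type*} [MeasurableSpace X] {ν : Measure X} [IsProbabilityMeasure ν]

/-! By Green–Kubo, `D - D^s` is `-1/(4χ)` times the matrix of time integrals of `⟨j_α | T_t j_β⟩`.
Each diagonal integrand equals `‖T_{t/2} j_α‖²`, which is nonnegative and continuous in `t`, so a
zero integral forces `⟨j_α | j_α⟩ = 0`. Everything then rests on one fact: a centred local function
has zero seminorm in `ℋ` if and only if it is a gradient.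

Gradients have zero seminorm by shift invariance. For the converse
(`mem_grad_of_scalar_self_eq_zero`), order `ℤ^d` lexicographically. Averaging out one site at a
time, from the smallest up, splits a local function into a constant and pieces that average to zero
over their smallest site. Translating each piece so that this site becomes `0` changes the function
only by a gradient. The resulting `g` is orthogonal to its nontrivial translates, so `⟨g | g⟩ =
‖g‖²`, and zero seminorm forces `g = 0`.

In the nearest-neighbour case, `j_α` is `2 j_{0,e_α}` modulo gradients, because reversing a bond
changes the sign of its current up to a shift. -/

theorem DependsOnly.sub {A : Set (Lat d)} {f g : L2 d ν} (hf : DependsOnly A f)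
    (hg : DependsOnly A g) : DependsOnly A (f - g) := by
  simpa [sub_eq_add_neg] using hf.add (hg.smul (-1))

theorem dependsOnly_oneFun (A : Set (Lat d)) : DependsOnly A (oneFun d ν : L2 d ν) :=
  ⟨fun _ => 1, measurable_const, fun _ _ _ => rfl, MemLp.coeFn_toLp (memLp_const (1 : ℝ))⟩

/-! ### The gradient space -/

variable (d ν) in
/-- The gradient space `𝔊` as a submodule of `𝒟`. -/
def gradSubmodule : Submodule ℝ (LocalL2 d ν) :=
  LinearMap.range (∑ α, (shift (unitVec α) - LinearMap.id) ∘ₗ LinearMap.proj α :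
    (Fin d → LocalL2 d ν) →ₗ[ℝ] LocalL2 d ν)

theorem mem_gradSubmodule {f : LocalL2 d ν} : f ∈ gradSubmodule d ν ↔ f ∈ gradSpace d ν := by
  simp only [gradSubmodule, LinearMap.mem_range, gradSpace, Set.mem_ofPred_eq]
  refine exists_congr fun g => ?_
  simp [LinearMap.sum_apply, eq_comm]

theorem shift_unitVec_sub_mem (α : Fin d) (f : LocalL2 d ν) :
    shift (unitVec α) f - f ∈ gradSubmodule d ν := by
  classical
  rw [mem_gradSubmodule]
  refine ⟨Pi.single α f, ?_⟩
  rw [Finset.sum_eq_single α]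
  · simp
  · intro β _ h
    simp [Pi.single_eq_of_ne h]
  · simp

variable (d ν) in
/-- The translations that act trivially modulo gradients. -/
def gradTranslations : AddSubgroup (Lat d) where
  carrier := {x | ∀ f : LocalL2 d ν, shift x f - f ∈ gradSubmodule d ν}
  zero_mem' f := by simp [shift_zero]
  add_mem' := by
    intro x y hx hy f
    -- Telescoping: `τ_{x+y} f - f = (τ_y τ_x f - τ_x f) + (τ_x f - f)`.
    have := add_mem (hy (shift x f)) (hx f)
    rwa [shift_shift, sub_add_sub_cancel] at this
  neg_mem' := by
    intro x hx f
    have := neg_mem (hx (shift (-x) f))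
    rwa [shift_shift, neg_add_cancel, shift_zero, neg_sub] at this

/-- The translations acting trivially modulo gradients form a subgroup containing the unit vectors,
which generate `ℤ^d`. -/
theorem shift_sub_mem (x : Lat d) (f : LocalL2 d ν) : shift x f - f ∈ gradSubmodule d ν := by
  have hx : x ∈ gradTranslations d ν := by
    have e : x = ∑ α, x α • unitVec α := by
      classical
      funext β
      simp [unitVec, Finset.sum_apply, Pi.single_apply]
    rw [e]
    refine sum_mem fun α _ => zsmul_mem ?_ _
    exact fun f => shift_unitVec_sub_mem α f
  exact hx f

/-! ### Vanishing of the mean and the scalar product on gradients. -/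

theorem mean_sub (f g : LocalL2 d ν) : mean (f - g) = mean f - mean g := by
  simp [mean_eq_inner, inner_sub_right]

theorem scalar_sub_left (f g h : LocalL2 d ν) : scalar (f - g) h = scalar f h - scalar g h := by
  have := scalar_add_left (f - g) g h
  rw [sub_add_cancel] at this
  linarith

theorem scalar_shift_left (z : Lat d) (f g : LocalL2 d ν) :
    scalar (shift z f) g = scalar f g := by
  unfold scalar
  rw [← (Equiv.addLeft z).tsum_eq (shiftCov f g)]
  refine tsum_congr fun x => ?_
  simp [shiftCov, shift_shift, mean_shift]

theorem mean_eq_zero_of_mem_grad {f : LocalL2 d ν} (hf : f ∈ gradSubmodule d ν) : mean f = 0 := by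
  obtain ⟨g, rfl⟩ := mem_gradSubmodule.1 hf
  rw [mean_eq_inner]
  simp only [AddSubmonoidClass.coe_finsetSum, inner_sum]
  exact Finset.sum_eq_zero fun α _ => by rw [← mean_eq_inner, mean_sub, mean_shift, sub_self]

/-- Summing over all translates makes the scalar product shift invariant in each argument, so every
difference `τ_{e_α} g_α - g_α` lies in its radical. -/
theorem scalar_eq_zero_of_mem_grad {f : LocalL2 d ν} (hf : f ∈ gradSubmodule d ν)
    (h : LocalL2 d ν) : scalar f h = 0 := by
  obtain ⟨g, rfl⟩ := mem_gradSubmodule.1 hf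
  induction (Finset.univ : Finset (Fin d)) using Finset.cons_induction with
  | empty => simpa using scalar_smul_left 0 (0 : LocalL2 d ν) h
  | cons α s hα ih =>
    rw [Finset.sum_cons, scalar_add_left, ih, scalar_sub_left, scalar_shift_left, sub_self,
      add_zero]

/-! ### Averaging over one coordinate -/

/-- Resampling one coordinate independently leaves a product measure invariant. This is what makes
averaging over that coordinate well behaved on `L²(μ)`. -/
theorem measurePreserving_update (a : Lat d) [DecidableEq (Lat d)] :
    MeasurePreserving (fun p : Conf d X × X => Function.update p.1 a p.2)
      ((prodMeasure d ν).prod ν) (prodMeasure d ν) := by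
  have hm : Measurable (fun p : Conf d X × X => Function.update p.1 a p.2) := by
    refine measurable_pi_lambda _ fun x => ?_
    by_cases h : x = a
    · subst h; simpa using measurable_snd
    · simpa [h] using (measurable_pi_apply (X := fun _ : Lat d => X) x).fun_comp measurable_fst
  refine ⟨hm, Measure.eq_infinitePi _ fun s t ht => ?_⟩
  rw [Measure.map_apply hm (MeasurableSet.pi s.countable_toSet fun i _ => ht i)]
  have hpre : (fun p : Conf d X × X => Function.update p.1 a p.2) ⁻¹' Set.pi s t =
      Set.pi (s.erase a : Finset (Lat d)) t ×ˢ (if a ∈ s then t a else Set.univ) := by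
    ext ⟨η, u⟩
    simp only [Set.mem_preimage, Set.mem_pi, Finset.mem_coe, Set.mem_prod, Finset.mem_erase]
    constructor
    · intro h
      refine ⟨fun i hi => by simpa [hi.1] using h i hi.2, ?_⟩
      split_ifs with ha
      · simpa using h a ha
      · trivial
    · rintro ⟨h1, h2⟩ i hi
      by_cases hia : i = a
      · subst hia; simpa [hi] using h2
      · simpa [hia] using h1 i ⟨hia, hi⟩
  rw [hpre, Measure.prod_prod, prodMeasure, Measure.infinitePi_pi _ fun i _ => ht i]
  split_ifs with ha
  · exact Finset.prod_erase_mul _ _ ha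
  · simp [Finset.erase_eq_of_notMem ha]

/-- Averaging over the coordinate `a` is the orthogonal projection onto the functions that do not
depend on it, and it creates no new dependence. -/
theorem DependsOnly.exists_average {A : Set (Lat d)} {f : L2 d ν} (hf : DependsOnly A f)
    (a : Lat d) : ∃ p : L2 d ν, DependsOnly (A \ {a}) p ∧
      ∀ h : L2 d ν, DependsOnly {a}ᶜ h → inner ℝ (f - p) h = 0 := by
  classical
  obtain ⟨f', hf', df, ef⟩ := hf
  have hU := measurePreserving_update (d := d) (X := X) (ν := ν) a
  have hfL : MemLp f' 2 (prodMeasure d ν) := (memLp_congr_ae ef).1 (Lp.memLp f)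
  set F : Conf d X → X → ℝ := fun η u => f' (Function.update η a u) with hF
  have hFm : Measurable (Function.uncurry F) := hf'.comp hU.measurable
  set p' : Conf d X → ℝ := fun η => ∫ u, F η u ∂ν with hp'
  have hpm : Measurable p' := hFm.stronglyMeasurable.integral_prod_right.measurable
  -- Averaging is an `L²` contraction: `|∫ F| ≤ ‖F‖₁ ≤ ‖F‖₂` on the probability space `(X, ν)`, and
  -- the squares integrate to `‖f‖₂²` by the invariance under resampling.
  have hpL : MemLp p' 2 (prodMeasure d ν) := by
    refine ⟨hpm.aestronglyMeasurable, ?_⟩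
    have hfin := hfL.2
    rw [eLpNorm_lt_top_iff_lintegral_rpow_enorm_lt_top (by simp) (by simp)] at hfin ⊢
    refine lt_of_le_of_lt ?_ hfin
    have e1 : ∫⁻ η, ‖f' η‖ₑ ^ (2 : ℝ≥0∞).toReal ∂prodMeasure d ν =
        ∫⁻ η, ∫⁻ u, ‖F η u‖ₑ ^ (2 : ℝ≥0∞).toReal ∂ν ∂prodMeasure d ν := by
      rw [← hU.lintegral_comp (hf'.enorm.pow_const _)]
      exact lintegral_prod _ ((hFm.enorm.pow_const _).aemeasurable)
    rw [e1]
    refine lintegral_mono fun η => ?_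
    have hs : AEStronglyMeasurable (F η) ν :=
      (hFm.comp measurable_prodMk_left).aestronglyMeasurable
    have h1 : ‖p' η‖ₑ ≤ eLpNorm (F η) 2 ν := by
      refine le_trans ?_ (eLpNorm_le_eLpNorm_of_exponent_le (p := 1) (by norm_num) hs)
      rw [eLpNorm_one_eq_lintegral_enorm]
      exact enorm_integral_le_lintegral_enorm _
    refine (ENNReal.rpow_le_rpow h1 (by simp)).trans_eq ?_
    rw [eLpNorm_eq_lintegral_rpow_enorm_toReal (by simp) (by simp), ← ENNReal.rpow_mul]
    simp
  refine ⟨hpL.toLp p', ⟨p', hpm, fun η ζ h => ?_, hpL.coeFn_toLp⟩, ?_⟩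
  · refine integral_congr_ae (.of_forall fun u => df fun i hi => ?_)
    -- At the site `a` both configurations carry the resampled value `u`, so agreement there is not
    -- needed.
    by_cases hia : i = a
    · subst hia; simp
    · simpa [hia] using h i ⟨hi, hia⟩
  · rintro h ⟨h', hh', dh, eh⟩
    have hhL : MemLp h' 2 (prodMeasure d ν) := (memLp_congr_ae eh).1 (Lp.memLp h)
    rw [inner_sub_left, sub_eq_zero, L2.inner_def, L2.inner_def]
    have hint : Integrable (fun η => f' η * h' η) (prodMeasure d ν) := hfL.integrable_mul hhL
    have e1 : ∫ η, inner ℝ (f η) (h η) ∂prodMeasure d ν = ∫ η, f' η * h' η ∂prodMeasure d ν := by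
      refine integral_congr_ae ?_
      filter_upwards [ef, eh] with η h1 h2
      simp [h1, h2, mul_comm]
    have e2 : ∫ η, inner ℝ (hpL.toLp p' η) (h η) ∂prodMeasure d ν =
        ∫ η, p' η * h' η ∂prodMeasure d ν := by
      refine integral_congr_ae ?_
      filter_upwards [hpL.coeFn_toLp, eh] with η h1 h2
      simp [h1, h2, mul_comm]
    rw [e1, e2]
    have hint' := hU.integrable_comp_of_integrable hint
    have e3 : ∫ η, f' η * h' η ∂prodMeasure d ν =
        ∫ q, f' (Function.update q.1 a q.2) * h' (Function.update q.1 a q.2)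
          ∂(prodMeasure d ν).prod ν := by
      have := integral_map (μ := (prodMeasure d ν).prod ν) hU.measurable.aemeasurable
        (f := fun η => f' η * h' η) (hf'.mul hh').aestronglyMeasurable
      rwa [hU.map_eq] at this
    refine (e3.trans (integral_prod _ hint')).trans ?_
    refine integral_congr_ae (.of_forall fun η => ?_)
    -- Resampling does not affect `h'`, so it leaves the inner integral of Fubini, and what remains
    -- is `p'`.
    have hh : ∀ u, h' (Function.update η a u) = h' η := fun u => dh fun i hi => by
      have : i ≠ a := hi
      simp [this]
    simp only [hh]
    rw [integral_mul_const]

/-! ### Local functions modulo gradients -/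

/-- Shifts are unitary. The second argument need not be local, so that it may be an image under the
semigroup. -/
theorem inner_shift_left (z : Lat d) (f : LocalL2 d ν) (v : L2 d ν) :
    inner ℝ (shift z f : L2 d ν) v = inner ℝ (f : L2 d ν) (shiftL2 ν (-z) v) := by
  have h := (shiftL2 ν (-z)).inner_map_map (shift z f : L2 d ν) v
  have e : shiftL2 ν (-z) (shift z f : L2 d ν) = f := by
    have := congrArg Subtype.val (shift_shift (-z) z f)
    rwa [add_neg_cancel, shift_zero] at this
  rw [← h, e]

theorem eq_smul_oneFun_of_dependsOnly_empty {f : LocalL2 d ν}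
    (hf : DependsOnly ∅ (f : L2 d ν)) : ∃ c : ℝ, f = c • oneFun d ν := by
  obtain ⟨f', -, df, ef⟩ := hf
  obtain ⟨x₀⟩ : Nonempty X := ν.nonempty_of_neZero
  refine ⟨f' fun _ => x₀, Subtype.ext (Lp.ext ?_)⟩
  have h1 : (oneFun d ν : L2 d ν) =ᵐ[prodMeasure d ν] fun _ => (1 : ℝ) :=
    MemLp.coeFn_toLp (memLp_const (1 : ℝ))
  filter_upwards [ef, h1, Lp.coeFn_smul (f' fun _ => x₀) (oneFun d ν : L2 d ν)] with η h2 h3 h4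
  rw [Submodule.coe_smul, h4, Pi.smul_apply, h3, h2]
  simpa using df (x := η) (y := fun _ => x₀) (by simp)

/-- Modulo gradients and constants, every local function is represented by one whose components
all have `0` as the lexicographically smallest site of their support. -/
theorem exists_normal_form (A : Finset (Lat d)) : ∀ f : LocalL2 d ν,
    DependsOnly (A : Set (Lat d)) (f : L2 d ν) → ∃ (g : LocalL2 d ν) (c : ℝ),
      f - g - c • oneFun d ν ∈ gradSubmodule d ν ∧
      DependsOnly {y | 0 ≤ toLex y} (g : L2 d ν) ∧
      ∀ h : L2 d ν, DependsOnly {y | 0 < toLex y} h → inner ℝ (g : L2 d ν) h = 0 := by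
  classical
  -- The inserted site `a` lies lexicographically below all of `s`, so the smallest site is the one
  -- averaged out.
  induction A using Finset.induction_on_min_value (toLex : Lat d → Lex (Lat d)) with
  | empty =>
    intro f hf
    obtain ⟨c, rfl⟩ := eq_smul_oneFun_of_dependsOnly_empty (by simpa using hf)
    refine ⟨0, c, by simp, ?_, by simp⟩
    simpa using (dependsOnly_oneFun (ν := ν) {y : Lat d | 0 ≤ toLex y}).smul 0
  | insert a s ha hmin ih =>
    intro f hf
    obtain ⟨p, hp, hperp⟩ := hf.exists_average a
    have hps : DependsOnly (s : Set (Lat d)) p := by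
      refine hp.mono ?_
      rintro y ⟨hy, hya⟩
      simpa [show y ≠ a from hya] using hy
    obtain ⟨g, c, hgrad, hg, hgp⟩ := ih ⟨p, s, hps⟩ hps
    set u : LocalL2 d ν := f - ⟨p, s, hps⟩ with hu
    have hud : DependsOnly ((insert a s : Finset (Lat d)) : Set (Lat d)) (u : L2 d ν) :=
      hf.sub (hps.mono (by simp))
    -- The part `u` has zero average over its smallest site `a`; the shift by `-a` moves that site
    -- to `0`. The part independent of `a` is handled by the induction hypothesis.
    refine ⟨shift (-a) u + g, c, ?_, (DependsOnly.mono ?_ (hud.shift (-a))).add hg, ?_⟩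
    · have h := sub_mem hgrad (shift_sub_mem (-a) u)
      have e : f - (shift (-a) u + g) - c • oneFun d ν =
          (⟨p, s, hps⟩ - g - c • oneFun d ν) - (shift (-a) u - u) := by
        have : f = u + ⟨p, s, hps⟩ := by rw [hu, sub_add_cancel]
        rw [this]; abel
      rwa [e]
    · rintro _ ⟨y, hy, rfl⟩
      have hay : toLex a ≤ toLex y := by
        rcases Finset.mem_insert.1 (Finset.mem_coe.1 hy) with rfl | hy
        · exact le_rfl
        · exact hmin y hy
      have : (0 : Lex (Lat d)) ≤ toLex y - toLex a := sub_nonneg.2 hay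
      simpa [sub_eq_add_neg] using this
    · intro h hh
      have h1 : inner ℝ ((shift (-a) u : LocalL2 d ν) : L2 d ν) h = 0 := by
        rw [inner_shift_left, neg_neg]
        -- Translated by `a`, the test function lives strictly above `a`, hence does not depend on
        -- `a`.
        refine hperp _ (DependsOnly.mono ?_ (hh.shift a))
        rintro _ ⟨y, hy, rfl⟩ hya
        have : y = 0 := by simpa using hya
        subst this
        exact lt_irrefl (0 : Lex (Lat d)) hy
      rw [Submodule.coe_add, inner_add_left, h1, hgp h hh, add_zero]

/-- A centred local function of zero seminorm `⟨f | f⟩` is a gradient. -/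
theorem mem_grad_of_scalar_self_eq_zero {f : LocalL2 d ν} (hm : mean f = 0)
    (hf : scalar f f = 0) : f ∈ gradSubmodule d ν := by
  obtain ⟨A, hA⟩ := f.2
  obtain ⟨g, c, hgrad, hg, hperp⟩ := exists_normal_form A f hA
  have hone : mean (oneFun d ν) = 1 := by
    have h : (oneFun d ν : L2 d ν) =ᵐ[prodMeasure d ν] fun _ => (1 : ℝ) :=
      MemLp.coeFn_toLp (memLp_const (1 : ℝ))
    rw [mean, integral_congr_ae h]
    simp
  have hgm : mean g = 0 := by
    rw [mean_eq_inner, real_inner_comm]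
    -- Constants depend on no site, so they are among the functions orthogonal to `g`.
    exact hperp _ (dependsOnly_oneFun _)
  have hc : c = 0 := by
    have := mean_eq_zero_of_mem_grad hgrad
    rw [mean_sub, mean_sub, mean_smul, hone, hm, hgm] at this
    linarith
  subst hc
  rw [zero_smul, sub_zero] at hgrad
  -- For `x > 0` the translate `τ_x g` sees only strictly positive sites; negative `x` reduces to
  -- this by shifting back.
  have hpos : ∀ x : Lat d, 0 < toLex x →
      inner ℝ (g : L2 d ν) ((shift x g : LocalL2 d ν) : L2 d ν) = 0 := by
    intro x hx
    refine hperp _ (DependsOnly.mono ?_ (hg.shift x))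
    rintro _ ⟨y, hy, rfl⟩
    exact add_pos_of_nonneg_of_pos (a := toLex y) (b := toLex x) hy hx
  have hgg : scalar g g = inner ℝ (g : L2 d ν) (g : L2 d ν) := by
    rw [scalar, tsum_eq_single 0, shiftCov, shift_zero, hgm, mul_zero, sub_zero]
    intro x hx
    rw [shiftCov, hgm, mul_zero, sub_zero]
    rcases lt_trichotomy (toLex x) 0 with h | h | h
    · rw [inner_shift_left]
      exact hpos (-x) (neg_pos.2 h)
    · exact absurd h hx
    · rw [real_inner_comm]
      exact hpos x h
  -- Since `f - g` is a gradient and lies in the radical, `0 = ⟨f | f⟩ = ⟨g | g⟩ = ‖g‖²`.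
  have e1 : scalar f g = scalar g g := by
    have := scalar_eq_zero_of_mem_grad hgrad g
    rw [scalar_sub_left] at this
    linarith
  have e2 : scalar f f = scalar g f := by
    have := scalar_eq_zero_of_mem_grad hgrad f
    rw [scalar_sub_left] at this
    linarith
  rw [scalar_symm g f, e1, hgg, hf] at e2
  have hg0 : g = 0 := Subtype.ext (inner_self_eq_zero.1 e2.symm)
  rwa [hg0, sub_zero] at hgrad


/-! ### The induced semigroup -/

namespace IsInducedSemigroup

variable {P : ℝ≥0 → L2 d ν →L[ℝ] L2 d ν} {T : ℝ≥0 → Hilb d ν →L[ℝ] Hilb d ν}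

/-- Split `T_t = T_{t/2} T_{t/2}` and move one factor across by self-adjointness; this yields
nonnegativity of autocorrelations. -/
theorem inner_self_eq (hT : IsInducedSemigroup P T) (t : ℝ≥0) (h : Hilb d ν) :
    inner ℝ h (T t h) = ‖T (t / 2) h‖ ^ 2 := by
  have e : T t = T (t / 2) * T (t / 2) := by rw [← hT.add, add_halves]
  have hs := (hT.selfAdjoint (t / 2)).isSymmetric
  rw [e, mul_apply_eq_comp, ← real_inner_self_eq_norm_sq]
  exact (hs h (T (t / 2) h)).symm

/-- The space-time correlation sum of centred local functions in terms of the induced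
semigroup. -/
theorem hasSum_inner_shift (hT : IsInducedSemigroup P T)
    (hP : ∀ t z f, P t (shiftL2 ν z f) = shiftL2 ν z (P t f)) {f g : LocalL2 d ν}
    (hf : mean f = 0) (t : ℝ≥0) :
    HasSum (fun x : Lat d => inner ℝ (f : L2 d ν) (P t (shift x g : L2 d ν)))
      (inner ℝ (toHilb f) (T t (toHilb g))) := by
  have h := hT.induced t f g
  -- Moving the shift from the first argument to the second reverses its sign; it then commutes with
  -- `P`.
  rw [← (Equiv.neg (Lat d)).hasSum_iff] at h
  have e : (fun x : Lat d => inner ℝ (f : L2 d ν) (P t (shift x g : L2 d ν))) =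
      (fun x : Lat d => inner ℝ (shift x f : L2 d ν) (P t (g : L2 d ν)) - mean f * mean g) ∘
        Equiv.neg (Lat d) := by
    funext x
    rw [Function.comp_apply, Equiv.neg_apply, inner_shift_left, neg_neg, ← hP, hf, zero_mul,
      sub_zero]
    rfl
  rwa [e]

/-- If the time integral of the autocorrelation vanishes, so does the seminorm. -/
theorem scalar_self_eq_zero (hT : IsInducedSemigroup P T) {f : LocalL2 d ν}
    (hint : IntegrableOn (fun t : ℝ => inner ℝ (toHilb f) (T t.toNNReal (toHilb f))) (Set.Ioi 0))
    (h0 : ∫ t in Set.Ioi (0 : ℝ), inner ℝ (toHilb f) (T t.toNNReal (toHilb f)) = 0) :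
    scalar f f = 0 := by
  set φ : ℝ → ℝ := fun t => inner ℝ (toHilb f) (T t.toNNReal (toHilb f)) with hφ
  have hc : Continuous φ :=
    continuous_const.inner ((hT.continuous (toHilb f)).comp continuous_real_toNNReal)
  have hnn : ∀ t, 0 ≤ φ t := fun t => by
    simp only [hφ, hT.inner_self_eq]; positivity
  have hae := (setIntegral_eq_zero_iff_of_nonneg_ae (.of_forall hnn) hint).1 h0
  -- Continuity upgrades vanishing almost everywhere to vanishing on `(0, ∞)`, and then at `t = 0`,
  -- where `T 0 = 1` gives the seminorm.
  have heq : Set.EqOn φ 0 (Set.Ioi 0) :=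
    Measure.eqOn_open_of_ae_eq hae isOpen_Ioi hc.continuousOn continuousOn_const
  have hcl : Set.EqOn φ 0 (closure (Set.Ioi 0)) := heq.closure hc continuous_const
  have := hcl (x := 0) (by simp)
  rw [← inner_toHilb]
  simpa [hφ, hT.zero] using this

end IsInducedSemigroup

/-! ### Currents -/

theorem shift_siteObs {φ : X → ℝ} (hφ : Measurable φ) (h2 : MemLp φ 2 ν) (x z : Lat d) :
    shift z (siteObs hφ h2 x) = siteObs hφ h2 (x + z) := by
  have hz := measurePreserving_shiftConf (X := X) (d := d) ν z
  refine Subtype.ext (Lp.ext ?_)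
  have h1 : ((shift z (siteObs hφ h2 x) : LocalL2 d ν) : L2 d ν) =ᵐ[prodMeasure d ν]
      ((siteObs hφ h2 x : L2 d ν) : Conf d X → ℝ) ∘ shiftConf z :=
    Lp.coeFn_compMeasurePreserving (siteObs hφ h2 x : L2 d ν) hz
  have h3 : ∀ y, ((siteObs hφ h2 y : LocalL2 d ν) : L2 d ν) =ᵐ[prodMeasure d ν]
      fun η => φ (η y) := fun y =>
    MemLp.coeFn_toLp (h2.comp_measurePreserving
      (measurePreserving_eval_infinitePi (fun _ : Lat d => ν) y))
  exact (h1.trans (hz.quasiMeasurePreserving.ae_eq_comp (h3 x))).trans (h3 (x + z)).symm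

namespace ParticleSystem

variable (𝓢 : ParticleSystem d ν)

/-- Symmetry of `L_{0,x}` and `L_{0,x} 1 = 0`. -/
theorem mean_bondCurrent (x : Lat d) : mean (𝓢.bondCurrent x) = 0 := by
  rw [bondCurrent, mean_smul, mean_eq_inner, ← 𝓢.reversible, 𝓢.map_one]
  simp

/-- Centring is essential for the gradient criterion: constants have zero seminorm but, unless zero,
are not gradients. -/
theorem mean_current (α : Fin d) : mean (𝓢.current α) = 0 := by
  refine finsum_induction (fun f : LocalL2 d ν => mean f = 0) ?_ ?_ fun x => ?_
  · simp [mean_eq_inner]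
  · intro f g hf hg
    rw [mean_add, hf, hg, add_zero]
  · rw [mean_smul, mean_bondCurrent, mul_zero]

/-- Symmetry and translation covariance turn `L_{0,-x} ξ_0` into `τ_{-x} L_{0,x} ξ_x`; conservation
replaces `ξ_x` by `-ξ_0`. -/
theorem bondCurrent_neg (x : Lat d) :
    𝓢.bondCurrent (-x) = -shift (-x) (𝓢.bondCurrent x) := by
  have h1 : 𝓢.L 0 (-x) (𝓢.ξAt 0) = shift (-x) (𝓢.L 0 x (𝓢.ξAt x)) := by
    rw [𝓢.symmetric, 𝓢.translation, zero_sub, neg_neg, ξAt, shift_siteObs, zero_add]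
    rfl
  have h2 : 𝓢.L 0 x (𝓢.ξAt x) = -𝓢.L 0 x (𝓢.ξAt 0) := by
    have := 𝓢.conserved 0 x
    rw [map_add] at this
    exact eq_neg_of_add_eq_zero_right this
  rw [bondCurrent, bondCurrent, h1, h2, map_neg, map_smul, smul_neg]

theorem current_of_nearestNeighbour (h : 𝓢.NearestNeighbour) (α : Fin d) :
    𝓢.current α = 𝓢.bondCurrent (unitVec α) - 𝓢.bondCurrent (-unitVec α) := by
  classical
  have hne : unitVec α ≠ -unitVec α := fun he => by
    have := congrFun he α
    simp [unitVec] at this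
  -- The weight `x_α` kills the bonds in all directions other than `±e_α`.
  have hsupp : Function.support (fun x : Lat d => ((x α : ℤ) : ℝ) • 𝓢.bondCurrent x) ⊆
      (({unitVec α, -unitVec α} : Finset (Lat d)) : Set (Lat d)) := by
    intro x hx
    by_contra hxn
    simp only [Finset.coe_insert, Finset.coe_singleton, Set.mem_insert_iff,
      Set.mem_singleton_iff, not_or] at hxn
    apply hx
    by_cases hz : ∀ β, x ≠ unitVec β ∧ x ≠ -unitVec β
    · simp [bondCurrent, h x hz]
    · simp only [not_forall, not_and_or, not_not] at hz
      obtain ⟨β, rfl | rfl⟩ := hz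
      · have : α ≠ β := fun e => hxn.1 (by rw [e])
        simp [unitVec, Pi.single_eq_of_ne this]
      · have : α ≠ β := fun e => hxn.2 (by rw [e])
        simp [unitVec, Pi.single_eq_of_ne this]
  rw [current, finsum_eq_sum_of_support_subset _ hsupp, Finset.sum_pair hne]
  simp [unitVec, sub_eq_add_neg]

/-- Bond reversal gives `j_α = 2j + (τ_{-e_α} j - j)` with `j = j_{0,e_α}`, and the bracket is a
gradient. -/
theorem current_mem_grad_iff (h : 𝓢.NearestNeighbour) (α : Fin d) :
    𝓢.current α ∈ gradSubmodule d ν ↔ 𝓢.bondCurrent (unitVec α) ∈ gradSubmodule d ν := by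
  set j := 𝓢.bondCurrent (unitVec α) with hj
  have e : 𝓢.current α = (2 : ℝ) • j + (shift (-unitVec α) j - j) := by
    rw [𝓢.current_of_nearestNeighbour h, 𝓢.bondCurrent_neg, ← hj, two_smul]
    abel
  rw [e, Submodule.add_mem_iff_left _ (shift_sub_mem _ _),
    Submodule.smul_mem_iff _ two_ne_zero]

/-- The Green–Kubo formula in terms of the induced semigroup. -/
theorem GreenKubo.sub_staticMatrix {𝓢 : ParticleSystem d ν} {P : ℝ≥0 → L2 d ν →L[ℝ] L2 d ν}
    {T : ℝ≥0 → Hilb d ν →L[ℝ] Hilb d ν} {χ : ℝ} {D : Matrix (Fin d) (Fin d) ℝ}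
    (hGK : 𝓢.GreenKubo P χ D) (hT : IsInducedSemigroup P T)
    (hP : ∀ t z f, P t (shiftL2 ν z f) = shiftL2 ν z (P t f)) (α β : Fin d) :
    IntegrableOn (fun t : ℝ =>
      inner ℝ (toHilb (𝓢.current α)) (T t.toNNReal (toHilb (𝓢.current β)))) (Set.Ioi 0) ∧
    D α β = 𝓢.staticMatrix χ α β - (4 * χ)⁻¹ * ∫ t in Set.Ioi (0 : ℝ),
      inner ℝ (toHilb (𝓢.current α)) (T t.toNNReal (toHilb (𝓢.current β))) := by
  obtain ⟨-, hint, hD⟩ := hGK α β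
  have hs : ∀ t : ℝ, ∑' x : Lat d, inner ℝ (𝓢.current α : L2 d ν)
      (P t.toNNReal (shift x (𝓢.current β) : L2 d ν)) =
      inner ℝ (toHilb (𝓢.current α)) (T t.toNNReal (toHilb (𝓢.current β))) := fun t =>
    (hT.hasSum_inner_shift hP (𝓢.mean_current α) t.toNNReal).tsum_eq
  simp only [hs] at hint hD
  refine ⟨hint, ?_⟩
  -- The prefactor `1/(2χ)` times `2` gives the `1/χ` of `D^s`; times `1/2` it gives `1/(4χ)`.
  rw [hD, staticMatrix, Matrix.of_apply, one_div, mul_inv, mul_inv]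
  ring

theorem gradientCondition_iff {𝓢 : ParticleSystem d ν} {P : ℝ≥0 → L2 d ν →L[ℝ] L2 d ν}
    {T : ℝ≥0 → Hilb d ν →L[ℝ] Hilb d ν} {χ : ℝ} (hχ : χ ≠ 0) {D : Matrix (Fin d) (Fin d) ℝ}
    (hGK : 𝓢.GreenKubo P χ D) (hT : IsInducedSemigroup P T)
    (hP : ∀ t z f, P t (shiftL2 ν z f) = shiftL2 ν z (P t f)) :
    𝓢.GradientCondition ↔ D = 𝓢.staticMatrix χ := by
  constructor
  · intro h
    ext α β
    -- A gradient current is the zero vector of `ℋ`, so off-diagonal correlations vanish as well.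
    have hj : toHilb (𝓢.current α) = 0 := by
      rw [← inner_self_eq_zero (𝕜 := ℝ), inner_toHilb]
      exact scalar_eq_zero_of_mem_grad (mem_gradSubmodule.2 (h α)) _
    rw [(hGK.sub_staticMatrix hT hP α β).2]
    simp [hj]
  · intro h α
    -- Only the diagonal entries are needed: there the integrand has a sign.
    obtain ⟨hint, hD⟩ := hGK.sub_staticMatrix hT hP α α
    have h0 : ∫ t in Set.Ioi (0 : ℝ),
        inner ℝ (toHilb (𝓢.current α)) (T t.toNNReal (toHilb (𝓢.current α))) = 0 := by
      rw [h] at hD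
      have := mul_eq_zero.1 (sub_eq_self.1 hD.symm)
      exact this.resolve_left (inv_ne_zero (by simpa using hχ))
    exact mem_gradSubmodule.1
      (mem_grad_of_scalar_self_eq_zero (𝓢.mean_current α) (hT.scalar_self_eq_zero hint h0))

end ParticleSystem

end LatticeSystem

end

theorem corollary2p2 {d : ℕ} {X : Type*} [MeasurableSpace X]
    (ν : Measure X) [IsProbabilityMeasure ν] [TopologicalSpace.SeparableSpace (Lp ℝ 2 ν)]
    (𝓢 : ParticleSystem d ν)
    {S : Type*} [MeasurableSpace S] (Q : Measure S) [IsProbabilityMeasure Q]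
    (η : ℝ≥0 → S → Conf d X)
    (P : ℝ≥0 → L2 d ν →L[ℝ] L2 d ν) (hP : 𝓢.IsMarkovDynamics Q η P)
    (T : ℝ≥0 → Hilb d ν →L[ℝ] Hilb d ν) (hT : IsInducedSemigroup P T)
    (χ : ℝ) (hχ : 𝓢.IsCompressibility Q η χ) (hχ0 : χ ≠ 0)
    (D : Matrix (Fin d) (Fin d) ℝ) (hD : 𝓢.IsDiffusionMatrix Q η χ D)
    (hGK : 𝓢.GreenKubo P χ D) (hVar : 𝓢.VariationalFormula T χ D) :
    (𝓢.GradientCondition ↔ D = 𝓢.staticMatrix χ) ∧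
    (𝓢.NearestNeighbour →
      (D = 𝓢.staticMatrix χ ↔ ∀ α, 𝓢.bondCurrent (unitVec α) ∈ gradSpace d ν)) := by
  have h := ParticleSystem.gradientCondition_iff hχ0 hGK hT hP.translation
  refine ⟨h, fun hNN => h.symm.trans (forall_congr' fun α => ?_)⟩
  rw [← mem_gradSubmodule, ← mem_gradSubmodule]
  exact 𝓢.current_mem_grad_iff hNN α
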